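/- Let $\mathbb{K}$ be $\mathbb{R}$ or $\mathbb{C}$. For Banach spaces $X_1,\dots,X_n$ ($n\ge 1$) over $\mathbb{K}$ let $\Sigma_{X_1,\dots,X_n}=\{x^1\otimes\cdots\otimes x^n : x^i\in X_i\}$ be the set of decomposable tensors in the algebraic tensor product $X_1\otimes\cdots\otimes X_n$. A \emph{reasonable crossnorm} on $X_1\otimes\cdots\otimes X_n$ is a norm $\beta$ with $\varepsilon\le\beta\le\pi$, where $\varepsilon$ and $\pi$ are the injective and the projective tensor norms. For subspaces $E_i\subset X_i$, the restriction $\beta|$ of $\beta$ to $E_1\otimes\cdots\otimes E_n$ is again a reasonable crossnorm. For a multilinear map $T$ on $X_1\times\cdots\times X_n$ let $\widetilde T$ denote its linearization on $X_1\otimes\cdots\otimes X_n$. A \emph{$\Sigma$-tensor norm on spaces} $\alpha$ assigns to every $n\ge1$, all Banach spaces $X_1,\dots,X_n,Y$ and every reasonable crossnorm $\beta$ on $X_1\otimes\cdots\otimes X_n$ a norm $\alpha^\beta=\alpha^\beta(\,\cdot\,;X_1,\dots,X_n,Y)$ on the algebraic tensor product $X_1\otimes\cdots\otimes X_n\otimes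 Y$ such that (S1) $\alpha^\beta((p-q)\otimes y)\le\beta(p-q)\,\|y\|$ for all $p,q\in\Sigma_{X_1,\dots,X_n}$ and $y\in Y$; (S2) for every multilinear form $\varphi$ on $X_1\times\cdots\times X_n$ whose linearization $\widetilde\varphi$ is $\beta$-bounded, with norm $\|\varphi\|_\beta$, and every $y^*\in Y^*$, the functional $\varphi\otimes y^*: x^1\otimes\cdots\otimes x^n\otimes y\mapsto\varphi(x^1,\dots,x^n)\,y^*(y)$ is $\alpha^\beta$-bounded with norm at most $\|\varphi\|_\beta\|y^*\|$; (S3) for all Banach spaces $Z_1,\dots,Z_m,W$ ($m\ge1$), every reasonable crossnorm $\theta$ on $Z_1\otimes\cdots\otimes Z_m$, every multilinear map $R:Z_1\times\cdots\times Z_m\to X_1\otimes\cdots\otimes X_n$ with values in $\Sigma_{X_1,\dots,X_n}$ whose linearization $\widetilde R:(Z_1\otimes\cdots\otimes Z_m,\theta)\to(X_1\otimes\cdots\otimes X_n,\beta)$ is bounded, and every bounded linear operator $S:W\to Y$, the operator $\widetilde R\otimes S:(Z_1\otimes\cdots\otimes Z_m\otimes W,\alpha^\theta)\to(X_1\otimes\cdots\otimes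 X_n\otimes Y,\alpha^\beta)$ is bounded with $\|\widetilde R\otimes S\|\le\|\widetilde R\|\,\|S\|$. It is \emph{finitely generated} if always $\alpha^\beta(u;X_1,\dots,X_n,Y)=\inf\alpha^{\beta|}(u;E_1,\dots,E_n,F)$, the infimum being taken over all finite dimensional subspaces $E_i\subset X_i$ and $F\subset Y$ such that $u\in E_1\otimes\cdots\otimes E_n\otimes F$. A linear functional $\varphi$ on $X_1\otimes\cdots\otimes X_n\otimes Y$ that is bounded for the projective norm has an associated bounded multilinear operator $T_\varphi:X_1\times\cdots\times X_n\to Y^*$, $\langle T_\varphi(x^1,\dots,x^n),y\rangle=\varphi(x^1\otimes\cdots\otimes x^n\otimes y)$, and its \emph{canonical extension} $\overline\varphi$ is the linear functional on $X_1\otimes\cdots\otimes X_n\otimes Y^{**}$ with $\overline\varphi(x^1\otimes\cdots\otimes x^n\otimes y^{**})=\langle y^{**},T_\varphi(x^1,\dots,x^n)\rangle$. \textbf{Proposition.} Let $\alpha$ be a finitely generated $\Sigma$-tensor norm on spaces, let $X_1,\dots,X_n,Y$ ($n\ge1$) be Banach spaces and let $\beta$ be a reasonable crossnorm on $X_1\otimes\cdots\otimes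 X_n$. Then: (i) $(X_1\otimes\cdots\otimes X_n\otimes Y,\alpha^\beta)$ is a closed subspace of $(X_1\otimes\cdots\otimes X_n\otimes Y^{**},\alpha^\beta)$: the linear map $I\otimes K_Y$ induced by the canonical embedding $K_Y:Y\to Y^{**}$ is isometric and has closed range. (ii) A linear functional $\varphi$ on $X_1\otimes\cdots\otimes X_n\otimes Y$ is $\alpha^\beta$-bounded if and only if it is bounded for the projective norm (so that $\overline\varphi$ is defined) and $\overline\varphi$ is $\alpha^\beta$-bounded on $X_1\otimes\cdots\otimes X_n\otimes Y^{**}$. In this situation $\|\varphi\|=\|\overline\varphi\|$. -/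

import Mathlib

open scoped TensorProduct Topology

universe u v w

noncomputable section

namespace SigmaTensor

/-! ### Bounded linear maps between spaces carrying explicitly given norms -/

section Bounded

variable {𝕜 : Type} [RCLike 𝕜] {V : Type v} [AddCommGroup V] [Module 𝕜 V]
  {W : Type w} [AddCommGroup W] [Module 𝕜 W]

/-- The linear map `T` is bounded from `(V, p)` to `(W, q)`. -/
def IsBdd (p : V → ℝ) (q : W → ℝ) (T : V →ₗ[𝕜] W) : Prop :=
  ∃ C : ℝ, ∀ v, q (T v) ≤ C * p v

/-- The operator norm of `T : (V, p) → (W, q)`, the least `C ≥ 0` with `q (T v) ≤ C * p v`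
(meaningful when `T` is bounded). -/
def opNorm (p : V → ℝ) (q : W → ℝ) (T : V →ₗ[𝕜] W) : ℝ :=
  sInf {C : ℝ | 0 ≤ C ∧ ∀ v, q (T v) ≤ C * p v}

/-- The topology of the space `(V, p)`. -/
abbrev normTopology (p : Seminorm 𝕜 V) : TopologicalSpace V :=
  p.toAddGroupSeminorm.toSeminormedAddCommGroup.toUniformSpace.toTopologicalSpace

end Bounded

/-! ### Decomposable tensors and reasonable crossnorms -/

section Crossnorm

variable (𝕜 : Type) [RCLike 𝕜] {n : ℕ} (X : Fin n → Type u)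
  [∀ i, NormedAddCommGroup (X i)] [∀ i, NormedSpace 𝕜 (X i)]

/-- The set `Σ` of decomposable tensors of `X₁ ⊗ ⋯ ⊗ Xₙ`. -/
def decomposable : Set (⨂[𝕜] i, X i) :=
  {p | ∃ x : ∀ i, X i, p = ⨂ₜ[𝕜] i, x i}

variable {𝕜 X}

/-- The functional `x₁* ⊗ ⋯ ⊗ xₙ*` on `X₁ ⊗ ⋯ ⊗ Xₙ`, which maps `x₁ ⊗ ⋯ ⊗ xₙ` to
`x₁*(x₁) ⋯ xₙ*(xₙ)`. -/
def dualTensor (f : ∀ i, StrongDual 𝕜 (X i)) : (⨂[𝕜] i, X i) →ₗ[𝕜] 𝕜 :=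
  PiTensorProduct.lift
    ((MultilinearMap.mkPiAlgebra 𝕜 (Fin n) 𝕜).compLinearMap fun i => (f i).toLinearMap)

theorem dualTensor_tprod (f : ∀ i, StrongDual 𝕜 (X i)) (x : ∀ i, X i) :
    dualTensor f (⨂ₜ[𝕜] i, x i) = ∏ i, f i (x i) := by
  simp [dualTensor]

/-- The injective norm `ε` on `X₁ ⊗ ⋯ ⊗ Xₙ`. -/
def injectiveNorm (u : ⨂[𝕜] i, X i) : ℝ :=
  sSup {r : ℝ | ∃ f : ∀ i, StrongDual 𝕜 (X i), (∀ i, ‖f i‖ ≤ 1) ∧ r = ‖dualTensor f u‖}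

theorem norm_dualTensor_le (f : ∀ i, StrongDual 𝕜 (X i)) (hf : ∀ i, ‖f i‖ ≤ 1)
    (u : ⨂[𝕜] i, X i) : ‖dualTensor f u‖ ≤ PiTensorProduct.projectiveSeminorm u := by
  let g : ContinuousMultilinearMap 𝕜 X 𝕜 :=
    ((MultilinearMap.mkPiAlgebra 𝕜 (Fin n) 𝕜).compLinearMap
      fun i => (f i).toLinearMap).mkContinuous 1 (by
        intro x
        simp only [MultilinearMap.compLinearMap_apply, MultilinearMap.mkPiAlgebra_apply, one_mul,
          norm_prod]
        refine Finset.prod_le_prod (fun i _ => norm_nonneg _) fun i _ => ?_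
        exact (f i).le_of_opNorm_le_of_le (hf i) le_rfl |>.trans (by simp))
  have hg : ‖g‖ ≤ 1 := MultilinearMap.mkContinuous_norm_le _ zero_le_one _
  have h := PiTensorProduct.norm_eval_le_projectiveSeminorm g u
  exact h.trans (mul_le_of_le_one_left (norm_nonneg u) hg)

theorem norm_dualTensor_le_injectiveNorm (f : ∀ i, StrongDual 𝕜 (X i)) (hf : ∀ i, ‖f i‖ ≤ 1)
    (u : ⨂[𝕜] i, X i) : ‖dualTensor f u‖ ≤ injectiveNorm u := by
  refine le_csSup ⟨PiTensorProduct.projectiveSeminorm u, ?_⟩ ⟨f, hf, rfl⟩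
  rintro _ ⟨g, hg, rfl⟩
  exact norm_dualTensor_le g hg u

variable (𝕜 X)

/-- A reasonable crossnorm on `X₁ ⊗ ⋯ ⊗ Xₙ`: a norm `β` with `ε ≤ β ≤ π`.
(`PiTensorProduct.projectiveSeminorm` is the projective norm `π`.) -/
structure ReasonableCrossnorm where
  toSeminorm : Seminorm 𝕜 (⨂[𝕜] i, X i)
  eq_zero_of_apply_eq_zero : ∀ u, toSeminorm u = 0 → u = 0
  injectiveNorm_le : ∀ u, injectiveNorm u ≤ toSeminorm u
  le_projectiveNorm : ∀ u, toSeminorm u ≤ PiTensorProduct.projectiveSeminorm u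

variable {𝕜 X}

instance : CoeFun (ReasonableCrossnorm 𝕜 X) (fun _ => (⨂[𝕜] i, X i) → ℝ) :=
  ⟨fun β => β.toSeminorm⟩

/-- The inclusion of `E₁ ⊗ ⋯ ⊗ Eₙ` into `X₁ ⊗ ⋯ ⊗ Xₙ`, for subspaces `Eᵢ ⊆ Xᵢ`. -/
def inclusion (E : ∀ i, Submodule 𝕜 (X i)) : (⨂[𝕜] i, E i) →ₗ[𝕜] ⨂[𝕜] i, X i :=
  PiTensorProduct.map fun i => (E i).subtype

theorem inclusion_injective (E : ∀ i, Submodule 𝕜 (X i)) :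
    Function.Injective (inclusion E) := by
  choose g hg using fun i => (E i).subtype.exists_leftInverse_of_injective (E i).ker_subtype
  have h : (PiTensorProduct.map g) ∘ₗ inclusion E = LinearMap.id := by
    rw [inclusion, ← PiTensorProduct.map_comp]
    simp only [hg]
    exact PiTensorProduct.map_id
  intro a b hab
  have := congrArg (PiTensorProduct.map g) hab
  simpa [← LinearMap.comp_apply, h] using this

theorem projectiveSeminorm_inclusion_le (E : ∀ i, Submodule 𝕜 (X i)) (u : ⨂[𝕜] i, E i) :
    PiTensorProduct.projectiveSeminorm (inclusion E u) ≤
      PiTensorProduct.projectiveSeminorm u := by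
  let g : ContinuousMultilinearMap 𝕜 (fun i => E i) (⨂[𝕜] i, X i) :=
    ((PiTensorProduct.tprod 𝕜).compLinearMap fun i => (E i).subtype).mkContinuous 1 (by
        intro x
        simpa using PiTensorProduct.projectiveSeminorm_tprod_le (𝕜 := 𝕜) fun i => (x i : X i))
  have hg : ‖g‖ ≤ 1 := MultilinearMap.mkContinuous_norm_le _ zero_le_one _
  have h := PiTensorProduct.norm_eval_le_projectiveSeminorm g u
  exact h.trans (mul_le_of_le_one_left (norm_nonneg u) hg)

/-- The restriction `β|` of a reasonable crossnorm to `E₁ ⊗ ⋯ ⊗ Eₙ`. -/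
def ReasonableCrossnorm.restrict (β : ReasonableCrossnorm 𝕜 X) (E : ∀ i, Submodule 𝕜 (X i)) :
    ReasonableCrossnorm 𝕜 (fun i => E i) where
  toSeminorm := β.toSeminorm.comp (inclusion E)
  eq_zero_of_apply_eq_zero u hu :=
    inclusion_injective E ((β.eq_zero_of_apply_eq_zero _ hu).trans (map_zero _).symm)
  injectiveNorm_le u := by
    refine Real.sSup_le ?_ (apply_nonneg _ _)
    rintro _ ⟨f, hf, rfl⟩
    choose g hg hgn using fun i => exists_extension_norm_eq (E i) (f i)
    have h : dualTensor f = dualTensor g ∘ₗ inclusion E := by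
      ext x
      simp [dualTensor, inclusion, hg]
    rw [h]
    exact (norm_dualTensor_le_injectiveNorm g (fun i => (hgn i).trans_le (hf i)) _).trans
      (β.injectiveNorm_le _)
  le_projectiveNorm u :=
    (β.le_projectiveNorm _).trans (projectiveSeminorm_inclusion_le E u)

end Crossnorm

/-! ### `Σ`-tensor norms on spaces -/

section SigmaOperator

variable {𝕜 : Type} [RCLike 𝕜] {n m : ℕ} {X : Fin n → Type u}
  [∀ i, NormedAddCommGroup (X i)] [∀ i, NormedSpace 𝕜 (X i)]
  {Z : Fin m → Type u} [∀ i, NormedAddCommGroup (Z i)] [∀ i, NormedSpace 𝕜 (Z i)]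

/-- The multilinear map `R : Z₁ × ⋯ × Zₘ → X₁ ⊗ ⋯ ⊗ Xₙ` has values in the decomposable tensors
and its linearization `(Z₁ ⊗ ⋯ ⊗ Zₘ, θ) → (X₁ ⊗ ⋯ ⊗ Xₙ, β)` is bounded, that is, `R` defines a
`Σ`-`β`-`θ`-operator. (As `θ ≤ π`, such an `R` is a bounded multilinear map.) -/
def IsSigmaOperator (β : ReasonableCrossnorm 𝕜 X) (θ : ReasonableCrossnorm 𝕜 Z)
    (R : MultilinearMap 𝕜 Z (⨂[𝕜] i, X i)) : Prop :=
  (∀ z, R z ∈ decomposable 𝕜 X) ∧ IsBdd θ β (PiTensorProduct.lift R)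

end SigmaOperator

/-- A `Σ`-tensor norm on spaces on the class of all Banach spaces over `𝕜`: to every `n ≥ 1`,
Banach spaces `X₁, …, Xₙ, Y` and reasonable crossnorm `β` on `X₁ ⊗ ⋯ ⊗ Xₙ` it assigns a norm
`α^β` on the algebraic tensor product `X₁ ⊗ ⋯ ⊗ Xₙ ⊗ Y` with the properties S1, S2, S3. -/
structure SigmaTensorNorm (𝕜 : Type) [RCLike 𝕜] where
  norm {n : ℕ} [NeZero n] (X : Fin n → Type u) [∀ i, NormedAddCommGroup (X i)]
    [∀ i, NormedSpace 𝕜 (X i)] [∀ i, CompleteSpace (X i)]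
    (Y : Type u) [NormedAddCommGroup Y] [NormedSpace 𝕜 Y] [CompleteSpace Y]
    (β : ReasonableCrossnorm 𝕜 X) : Seminorm 𝕜 ((⨂[𝕜] i, X i) ⊗[𝕜] Y)
  eq_zero_of_norm_eq_zero {n : ℕ} [NeZero n] (X : Fin n → Type u)
    [∀ i, NormedAddCommGroup (X i)] [∀ i, NormedSpace 𝕜 (X i)] [∀ i, CompleteSpace (X i)]
    (Y : Type u) [NormedAddCommGroup Y] [NormedSpace 𝕜 Y] [CompleteSpace Y]
    (β : ReasonableCrossnorm 𝕜 X) (u : (⨂[𝕜] i, X i) ⊗[𝕜] Y) (hu : norm X Y β u = 0) : u = 0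
  /-- S1 -/
  norm_sub_tmul_le {n : ℕ} [NeZero n] (X : Fin n → Type u)
    [∀ i, NormedAddCommGroup (X i)] [∀ i, NormedSpace 𝕜 (X i)] [∀ i, CompleteSpace (X i)]
    (Y : Type u) [NormedAddCommGroup Y] [NormedSpace 𝕜 Y] [CompleteSpace Y]
    (β : ReasonableCrossnorm 𝕜 X) (p q : ⨂[𝕜] i, X i) (hp : p ∈ decomposable 𝕜 X)
    (hq : q ∈ decomposable 𝕜 X) (y : Y) :
    norm X Y β ((p - q) ⊗ₜ[𝕜] y) ≤ β (p - q) * ‖y‖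
  /-- S2 -/
  functional_bound {n : ℕ} [NeZero n] (X : Fin n → Type u)
    [∀ i, NormedAddCommGroup (X i)] [∀ i, NormedSpace 𝕜 (X i)] [∀ i, CompleteSpace (X i)]
    (Y : Type u) [NormedAddCommGroup Y] [NormedSpace 𝕜 Y] [CompleteSpace Y]
    (β : ReasonableCrossnorm 𝕜 X) (φ : MultilinearMap 𝕜 X 𝕜)
    (hφ : IsBdd β (fun c : 𝕜 => ‖c‖) (PiTensorProduct.lift φ)) (f : StrongDual 𝕜 Y) :
    let φf : (⨂[𝕜] i, X i) ⊗[𝕜] Y →ₗ[𝕜] 𝕜 :=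
      LinearMap.mul' 𝕜 𝕜 ∘ₗ TensorProduct.map (PiTensorProduct.lift φ) f.toLinearMap
    IsBdd (norm X Y β) (fun c : 𝕜 => ‖c‖) φf ∧
      opNorm (norm X Y β) (fun c : 𝕜 => ‖c‖) φf ≤
        opNorm β (fun c : 𝕜 => ‖c‖) (PiTensorProduct.lift φ) * ‖f‖
  /-- S3 -/
  map_bound {n m : ℕ} [NeZero n] [NeZero m] (X : Fin n → Type u)
    [∀ i, NormedAddCommGroup (X i)] [∀ i, NormedSpace 𝕜 (X i)] [∀ i, CompleteSpace (X i)]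
    (Y : Type u) [NormedAddCommGroup Y] [NormedSpace 𝕜 Y] [CompleteSpace Y]
    (β : ReasonableCrossnorm 𝕜 X) (Z : Fin m → Type u)
    [∀ i, NormedAddCommGroup (Z i)] [∀ i, NormedSpace 𝕜 (Z i)] [∀ i, CompleteSpace (Z i)]
    (W : Type u) [NormedAddCommGroup W] [NormedSpace 𝕜 W] [CompleteSpace W]
    (θ : ReasonableCrossnorm 𝕜 Z) (R : MultilinearMap 𝕜 Z (⨂[𝕜] i, X i))
    (hR : IsSigmaOperator β θ R) (S : W →L[𝕜] Y) :
    let RS : (⨂[𝕜] i, Z i) ⊗[𝕜] W →ₗ[𝕜] (⨂[𝕜] i, X i) ⊗[𝕜] Y :=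
      TensorProduct.map (PiTensorProduct.lift R) S.toLinearMap
    IsBdd (norm Z W θ) (norm X Y β) RS ∧
      opNorm (norm Z W θ) (norm X Y β) RS ≤ opNorm θ β (PiTensorProduct.lift R) * ‖S‖

namespace SigmaTensorNorm

variable {𝕜 : Type} [RCLike 𝕜]

/-- The norm `α^{β|}` on `E₁ ⊗ ⋯ ⊗ Eₙ ⊗ F` for finite dimensional subspaces `Eᵢ ⊆ Xᵢ`,
`F ⊆ Y`. -/
def restrictNorm (α : SigmaTensorNorm.{u} 𝕜) {n : ℕ} [NeZero n] {X : Fin n → Type u}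
    [∀ i, NormedAddCommGroup (X i)] [∀ i, NormedSpace 𝕜 (X i)]
    {Y : Type u} [NormedAddCommGroup Y] [NormedSpace 𝕜 Y]
    (β : ReasonableCrossnorm 𝕜 X) (E : ∀ i, Submodule 𝕜 (X i)) (F : Submodule 𝕜 Y)
    [∀ i, FiniteDimensional 𝕜 (E i)] [FiniteDimensional 𝕜 F] :
    Seminorm 𝕜 ((⨂[𝕜] i, E i) ⊗[𝕜] F) :=
  haveI : ∀ i, CompleteSpace (E i) := fun i => FiniteDimensional.complete 𝕜 (E i)
  haveI : CompleteSpace F := FiniteDimensional.complete 𝕜 F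
  α.norm (fun i => E i) F (β.restrict E)

/-- `α` is finitely generated: `α^β(u; X₁, …, Xₙ, Y)` is the infimum of the numbers
`α^{β|}(u; E₁, …, Eₙ, F)` over all finite dimensional subspaces `Eᵢ ⊆ Xᵢ`, `F ⊆ Y` such that
`u` lies in `E₁ ⊗ ⋯ ⊗ Eₙ ⊗ F`. -/
def FinitelyGenerated (α : SigmaTensorNorm.{u} 𝕜) : Prop :=
  ∀ {n : ℕ} [NeZero n] (X : Fin n → Type u) [∀ i, NormedAddCommGroup (X i)]
    [∀ i, NormedSpace 𝕜 (X i)] [∀ i, CompleteSpace (X i)]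
    (Y : Type u) [NormedAddCommGroup Y] [NormedSpace 𝕜 Y] [CompleteSpace Y]
    (β : ReasonableCrossnorm 𝕜 X) (u : (⨂[𝕜] i, X i) ⊗[𝕜] Y),
    IsGLB {r : ℝ | ∃ (E : ∀ i, Submodule 𝕜 (X i)) (F : Submodule 𝕜 Y)
        (_ : ∀ i, FiniteDimensional 𝕜 (E i)) (_ : FiniteDimensional 𝕜 F)
        (v : (⨂[𝕜] i, E i) ⊗[𝕜] F),
        TensorProduct.map (inclusion E) F.subtype v = u ∧ r = α.restrictNorm β E F v}
      (α.norm X Y β u)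

end SigmaTensorNorm

/-! ### The canonical extension of a functional -/

section Extension

variable {𝕜 : Type} [RCLike 𝕜] {n : ℕ} {X : Fin n → Type u}
  [∀ i, NormedAddCommGroup (X i)] [∀ i, NormedSpace 𝕜 (X i)]
  {Y : Type u} [NormedAddCommGroup Y] [NormedSpace 𝕜 Y]

/-- The set of the numbers `∑ⱼ ‖xⱼ¹‖ ⋯ ‖xⱼⁿ‖ ‖yⱼ‖` over all the representations
`u = ∑ⱼ xⱼ¹ ⊗ ⋯ ⊗ xⱼⁿ ⊗ yⱼ`. -/
def projectiveSums (u : (⨂[𝕜] i, X i) ⊗[𝕜] Y) : Set ℝ :=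
  {r | ∃ (k : ℕ) (x : Fin k → ∀ i, X i) (y : Fin k → Y),
    u = ∑ j, (⨂ₜ[𝕜] i, x j i) ⊗ₜ[𝕜] y j ∧ r = ∑ j, (∏ i, ‖x j i‖) * ‖y j‖}

/-- The projective norm on `X₁ ⊗ ⋯ ⊗ Xₙ ⊗ Y`. -/
def projectiveNorm (u : (⨂[𝕜] i, X i) ⊗[𝕜] Y) : ℝ := sInf (projectiveSums u)

theorem projectiveNorm_nonneg (u : (⨂[𝕜] i, X i) ⊗[𝕜] Y) : 0 ≤ projectiveNorm u := by
  refine Real.sInf_nonneg ?_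
  rintro _ ⟨k, x, y, -, rfl⟩
  positivity

theorem projectiveNorm_tmul_le (x : ∀ i, X i) (y : Y) :
    projectiveNorm ((⨂ₜ[𝕜] i, x i) ⊗ₜ[𝕜] y) ≤ (∏ i, ‖x i‖) * ‖y‖ := by
  refine csInf_le ⟨0, ?_⟩ ⟨1, fun _ => x, fun _ => y, by simp, by simp⟩
  rintro _ ⟨k, x, y, -, rfl⟩
  positivity

/-- `φ` is a bounded functional on `X₁ ⊗_π ⋯ ⊗_π Xₙ ⊗_π Y`. -/
def IsProjectivelyBdd (φ : (⨂[𝕜] i, X i) ⊗[𝕜] Y →ₗ[𝕜] 𝕜) : Prop :=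
  IsBdd projectiveNorm (fun c : 𝕜 => ‖c‖) φ

theorem IsProjectivelyBdd.exists_bound {φ : (⨂[𝕜] i, X i) ⊗[𝕜] Y →ₗ[𝕜] 𝕜}
    (h : IsProjectivelyBdd φ) : ∃ C : ℝ, 0 ≤ C ∧ ∀ (x : ∀ i, X i) (y : Y),
      ‖φ ((⨂ₜ[𝕜] i, x i) ⊗ₜ[𝕜] y)‖ ≤ (C * ∏ i, ‖x i‖) * ‖y‖ := by
  obtain ⟨C, hC⟩ := h
  refine ⟨|C|, abs_nonneg C, fun x y => ?_⟩
  rw [mul_assoc]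
  calc _ ≤ C * projectiveNorm ((⨂ₜ[𝕜] i, x i) ⊗ₜ[𝕜] y) := hC _
    _ ≤ |C| * projectiveNorm ((⨂ₜ[𝕜] i, x i) ⊗ₜ[𝕜] y) :=
      mul_le_mul_of_nonneg_right (le_abs_self C) (projectiveNorm_nonneg _)
    _ ≤ _ := mul_le_mul_of_nonneg_left (projectiveNorm_tmul_le x y) (abs_nonneg C)

/-- The bounded functional `y ↦ φ(x₁ ⊗ ⋯ ⊗ xₙ ⊗ y)` on `Y`. -/
def slice (φ : (⨂[𝕜] i, X i) ⊗[𝕜] Y →ₗ[𝕜] 𝕜) (h : IsProjectivelyBdd φ) (x : ∀ i, X i) :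
    StrongDual 𝕜 Y :=
  LinearMap.mkContinuous (TensorProduct.curry φ (⨂ₜ[𝕜] i, x i))
    (h.exists_bound.choose * ∏ i, ‖x i‖) (h.exists_bound.choose_spec.2 x)

theorem slice_apply (φ : (⨂[𝕜] i, X i) ⊗[𝕜] Y →ₗ[𝕜] 𝕜) (h : IsProjectivelyBdd φ)
    (x : ∀ i, X i) (y : Y) : slice φ h x y = φ ((⨂ₜ[𝕜] i, x i) ⊗ₜ[𝕜] y) :=
  LinearMap.mkContinuous_apply _ _ (h.exists_bound.choose_spec.2 x) y

/-- The bounded multilinear operator `T_φ : X₁ × ⋯ × Xₙ → Y*` defined by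
`⟨T_φ(x₁, …, xₙ), y⟩ = φ(x₁ ⊗ ⋯ ⊗ xₙ ⊗ y)`. -/
def associatedOperator (φ : (⨂[𝕜] i, X i) ⊗[𝕜] Y →ₗ[𝕜] 𝕜) (h : IsProjectivelyBdd φ) :
    ContinuousMultilinearMap 𝕜 X (StrongDual 𝕜 Y) :=
  MultilinearMap.mkContinuous
    { toFun := slice φ h
      map_update_add' := fun x i a b => by
        ext y
        simp [slice_apply, MultilinearMap.map_update_add, TensorProduct.add_tmul]
      map_update_smul' := fun x i c a => by
        ext y
        simp [slice_apply, MultilinearMap.map_update_smul, ← TensorProduct.smul_tmul'] }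
    h.exists_bound.choose (fun x => LinearMap.mkContinuous_norm_le _
      (mul_nonneg h.exists_bound.choose_spec.1 (Finset.prod_nonneg fun _ _ => norm_nonneg _))
      (h.exists_bound.choose_spec.2 x))

theorem associatedOperator_apply (φ : (⨂[𝕜] i, X i) ⊗[𝕜] Y →ₗ[𝕜] 𝕜) (h : IsProjectivelyBdd φ)
    (x : ∀ i, X i) (y : Y) :
    associatedOperator φ h x y = φ ((⨂ₜ[𝕜] i, x i) ⊗ₜ[𝕜] y) :=
  slice_apply φ h x y

/-- The canonical extension `φ̄ : X₁ ⊗ ⋯ ⊗ Xₙ ⊗ Y** → 𝕜` of `φ`, the linear functional with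
`φ̄(x₁ ⊗ ⋯ ⊗ xₙ ⊗ y**) = ⟨y**, T_φ(x₁, …, xₙ)⟩`. -/
def canonicalExtension (φ : (⨂[𝕜] i, X i) ⊗[𝕜] Y →ₗ[𝕜] 𝕜) (h : IsProjectivelyBdd φ) :
    (⨂[𝕜] i, X i) ⊗[𝕜] StrongDual 𝕜 (StrongDual 𝕜 Y) →ₗ[𝕜] 𝕜 :=
  TensorProduct.lift
    ((ContinuousLinearMap.coeLM (M := StrongDual 𝕜 Y) (N₃ := 𝕜) 𝕜).flip ∘ₗ
      PiTensorProduct.lift (associatedOperator φ h).toMultilinearMap)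

theorem canonicalExtension_tmul (φ : (⨂[𝕜] i, X i) ⊗[𝕜] Y →ₗ[𝕜] 𝕜) (h : IsProjectivelyBdd φ)
    (x : ∀ i, X i) (g : StrongDual 𝕜 (StrongDual 𝕜 Y)) :
    canonicalExtension φ h ((⨂ₜ[𝕜] i, x i) ⊗ₜ[𝕜] g) = g (associatedOperator φ h x) := by
  simp [canonicalExtension]

variable (𝕜 X Y)

/-- The inclusion `I ⊗ K_Y` of `X₁ ⊗ ⋯ ⊗ Xₙ ⊗ Y` into `X₁ ⊗ ⋯ ⊗ Xₙ ⊗ Y**`, where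
`K_Y : Y → Y**` is the canonical embedding. -/
def bidualInclusion :
    (⨂[𝕜] i, X i) ⊗[𝕜] Y →ₗ[𝕜] (⨂[𝕜] i, X i) ⊗[𝕜] StrongDual 𝕜 (StrongDual 𝕜 Y) :=
  TensorProduct.map LinearMap.id (NormedSpace.inclusionInDoubleDual 𝕜 Y).toLinearMap

end Extension

end SigmaTensor

end

namespace SigmaTensor

/-! ### Bounded linear maps between seminormed spaces -/

section Bounded

variable {𝕜 : Type} [RCLike 𝕜] {V : Type v} [AddCommGroup V] [Module 𝕜 V]
  {W : Type w} [AddCommGroup W] [Module 𝕜 W]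

/-! Everything except the closedness in (i) rests on one estimate: if |φ| ≤ C·α^β on X₁⊗⋯⊗Xₙ⊗Y, then
|φ̄| ≤ C·α^β on X₁⊗⋯⊗Xₙ⊗Y**. By finite generation it suffices to bound φ̄ at a tensor v = ∑ eⱼ⊗xⱼ of
E₁⊗⋯⊗Eₙ⊗F with F ⊆ Y** finite dimensional. With yⱼ* = T_φ(eⱼ), S3 bounds the functional S ↦
φ((incl⊗S)v) = ∑ ⟨yⱼ*, S xⱼ⟩ on L(F, Y) by C·α^{β|}(v)·‖S‖, and φ̄(v) is its natural extension to
L(F, Y**), evaluated at the inclusion of F. The extension has no larger norm: this is the form of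
local reflexivity proved in `norm_sum_apply_bidual_le`.

The isometry in (i) follows. S3 applied to K_Y gives one inequality; a norming functional φ of u
gives the other, because φ̄ restricts to φ along I⊗K_Y. The same restriction identity gives the
converse and the equality of norms in (ii), while S1 yields α^β ≤ π, so that φ̄ exists for every
α^β-bounded φ.

The range in (i) is closed because each tensor outside it is separated from it by a functional ψ⊗h,
with h vanishing on the closed subspace K_Y(Y); S2 makes this functional bounded. -/

theorem opNorm_nonneg (p : V → ℝ) (q : W → ℝ) (T : V →ₗ[𝕜] W) : 0 ≤ opNorm p q T :=
  Real.sInf_nonneg fun _ h => h.1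

theorem opNorm_le {p : V → ℝ} {q : W → ℝ} {T : V →ₗ[𝕜] W} {C : ℝ} (hC : 0 ≤ C)
    (h : ∀ v, q (T v) ≤ C * p v) : opNorm p q T ≤ C :=
  csInf_le ⟨0, fun _ h => h.1⟩ ⟨hC, h⟩

theorem IsBdd.le_opNorm {p : V → ℝ} {q : W → ℝ} {T : V →ₗ[𝕜] W} (hp : ∀ v, 0 ≤ p v)
    (h : IsBdd p q T) (v : V) : q (T v) ≤ opNorm p q T * p v := by
  obtain ⟨C, hC⟩ := h
  -- Division by `p v` needs `p v ≠ 0`; if `p v = 0`, any bound already forces `q (T v) ≤ 0`.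
  rcases (hp v).eq_or_lt with h0 | h0
  · simpa [← h0] using hC v
  · rw [← div_le_iff₀ h0]
    refine le_csInf ⟨|C|, abs_nonneg C, fun w => (hC w).trans
      (mul_le_mul_of_nonneg_right (le_abs_self C) (hp w))⟩ fun D hD => ?_
    rw [div_le_iff₀ h0]
    exact hD.2 v

/-- Hahn–Banach along a linear map `J`, not assumed injective. -/
theorem exists_comp_eq_of_le_seminorm (J : V →ₗ[𝕜] W) (l : V →ₗ[𝕜] 𝕜) (p : Seminorm 𝕜 W)
    (h : ∀ v, ‖l v‖ ≤ p (J v)) :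
    ∃ g : W →ₗ[𝕜] 𝕜, (∀ v, g (J v) = l v) ∧ ∀ w, ‖g w‖ ≤ p w := by
  obtain ⟨s, hs⟩ := J.rangeRestrict.exists_rightInverse_of_surjective J.range_rangeRestrict
  have hs' : ∀ w : LinearMap.range J, J (s w) = w := fun w =>
    congrArg Subtype.val (LinearMap.congr_fun hs w)
  obtain ⟨g, hg, hgp⟩ := Module.Dual.exists_extension_of_le_seminorm (LinearMap.range J)
    (l ∘ₗ s) (p := p) fun w => by simpa [hs' w] using h (s w)
  refine ⟨g, fun v => ?_, hgp⟩
  have h1 := hg ⟨J v, v, rfl⟩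
  -- The bound by `p ∘ J` makes `l` vanish on the kernel of `J`, so the choice of the section `s`
  -- does not matter.
  have h2 : ‖l (s ⟨J v, v, rfl⟩ - v)‖ ≤ 0 := by
    refine (h _).trans ?_
    rw [map_sub, hs', sub_self, map_zero]
  rw [norm_le_zero_iff, map_sub, sub_eq_zero] at h2
  exact h1.trans h2

theorem exists_functional_apply_eq (p : Seminorm 𝕜 V) (v : V) :
    ∃ g : V →ₗ[𝕜] 𝕜, (∀ w, ‖g w‖ ≤ p w) ∧ ‖g v‖ = p v := by
  obtain ⟨g, hg, hgp⟩ := exists_comp_eq_of_le_seminorm (LinearMap.toSpanSingleton 𝕜 V v)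
    ((p v : 𝕜) • LinearMap.id) p fun c => by
      simp [map_smul_eq_mul, norm_smul, abs_of_nonneg, mul_comm]
  refine ⟨g, hgp, ?_⟩
  have := hg 1
  simp only [LinearMap.toSpanSingleton_apply, one_smul] at this
  simp [this]

theorem isClosed_of_forall_exists_functional (p : Seminorm 𝕜 V) (S : Set V)
    (h : ∀ u ∉ S, ∃ g : V →ₗ[𝕜] 𝕜, IsBdd p (fun c : 𝕜 => ‖c‖) g ∧ (∀ s ∈ S, g s = 0) ∧ g u ≠ 0) :
    IsClosed[normTopology p] S := by
  let := p.toAddGroupSeminorm.toSeminormedAddCommGroup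
  refine isClosed_of_closure_subset fun u hu => ?_
  by_contra huS
  obtain ⟨g, ⟨C, hC⟩, hS, hgu⟩ := h u huS
  have hg : Continuous g := AddMonoidHomClass.continuous_of_bound g C hC
  have : closure S ⊆ g ⁻¹' {0} :=
    closure_minimal (fun s hs => hS s hs) (isClosed_singleton.preimage hg)
  exact hgu (this hu)

end Bounded

/-! ### Duality between operators into a space and into its bidual -/

section Bidual

variable {𝕜 : Type} [RCLike 𝕜] {F : Type v} [NormedAddCommGroup F] [NormedSpace 𝕜 F]
  {Y : Type w} [NormedAddCommGroup Y] [NormedSpace 𝕜 Y]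

/-- An almost norming vector is rotated by a unimodular scalar to make the value of `f` real and
nonnegative, so that such values add up without cancellation. -/
theorem exists_norm_le_one_lt_apply (f : StrongDual 𝕜 Y) {r : ℝ} (hr : r < ‖f‖) :
    ∃ y : Y, ‖y‖ ≤ 1 ∧ r < ‖f y‖ ∧ f y = (‖f y‖ : 𝕜) := by
  obtain ⟨y, hy, hry⟩ := f.exists_lt_apply_of_lt_opNorm hr
  obtain ⟨c, hc, hcy⟩ := RCLike.exists_norm_eq_mul_self (f y)
  have h : ‖f (c • y)‖ = ‖f y‖ := by simp [hc]
  refine ⟨c • y, by simpa [norm_smul, hc] using hy.le, by rwa [h], ?_⟩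
  rw [h, hcy, map_smul, smul_eq_mul]

/-- The dual of `ℓ_∞^m(Y)` is `ℓ_1^m(Y*)`. -/
theorem exists_dual_components {m : Type*} [Fintype m] (g : (m → Y) →ₗ[𝕜] 𝕜)
    {C : ℝ} (hC : 0 ≤ C) (hg : ∀ y, ‖g y‖ ≤ C * ‖y‖) :
    ∃ f : m → StrongDual 𝕜 Y, (∀ y, g y = ∑ i, f i (y i)) ∧ ∑ i, ‖f i‖ ≤ C := by
  classical
  have hb : ∀ i y, ‖(g ∘ₗ LinearMap.single 𝕜 (fun _ : m => Y) i) y‖ ≤ C * ‖y‖ := fun i y =>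
    (hg _).trans_eq (by simp [Pi.norm_single])
  let f : m → StrongDual 𝕜 Y := fun i => LinearMap.mkContinuous _ C (hb i)
  have hf : ∀ y, g y = ∑ i, f i (y i) := fun y => by
    conv_lhs => rw [← Finset.univ_sum_single y, map_sum]
    rfl
  refine ⟨f, hf, le_of_forall_pos_le_add fun ε hε => ?_⟩
  -- The total error over the index set stays below `ε`; the `+ 1` covers an empty index set.
  let η : ℝ := ε / (Fintype.card m + 1)
  have hη : 0 < η := by positivity
  have hηε : Fintype.card m * η ≤ ε := by
    rw [mul_div_assoc', div_le_iff₀ (by positivity)]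
    nlinarith
  choose y hy hlt heq using fun i => exists_norm_le_one_lt_apply (f i) (sub_lt_self ‖f i‖ hη)
  calc ∑ i, ‖f i‖ ≤ ∑ i, (‖f i (y i)‖ + η) :=
        Finset.sum_le_sum fun i _ => (sub_lt_iff_lt_add.1 (hlt i)).le
    _ = ∑ i, ‖f i (y i)‖ + Fintype.card m * η := by simp [Finset.sum_add_distrib]
    _ = ‖g y‖ + Fintype.card m * η := by
        have : g y = ((∑ i, ‖f i (y i)‖ : ℝ) : 𝕜) := by
          rw [hf, RCLike.ofReal_sum]
          exact Finset.sum_congr rfl fun i _ => heq i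
        rw [this, RCLike.norm_of_nonneg (Finset.sum_nonneg fun i _ => norm_nonneg _)]
    _ ≤ C + ε := add_le_add ((hg y).trans
        (mul_le_of_le_one_right hC ((pi_norm_le_iff_of_nonneg zero_le_one).2 hy))) hηε

/-- Finitely many points of the unit ball almost determine the norm of all operators on a finite
dimensional space. -/
theorem exists_finite_norming (𝕜 : Type) [RCLike 𝕜] (F : Type v) [NormedAddCommGroup F]
    [NormedSpace 𝕜 F] [FiniteDimensional 𝕜 F] {δ : ℝ} (hδ : 0 < δ) :
    ∃ t : Finset F, (∀ x ∈ t, ‖x‖ ≤ 1) ∧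
      ∀ {Y : Type w} [NormedAddCommGroup Y] [NormedSpace 𝕜 Y] (S : F →L[𝕜] Y),
        (1 - δ) * ‖S‖ ≤ ‖fun x : t => S x‖ := by
  have : ProperSpace F := FiniteDimensional.proper_rclike 𝕜 F
  obtain ⟨t, ht, htf, hcov⟩ :=
    finite_cover_balls_of_compact (isCompact_closedBall (0 : F) 1) hδ
  lift t to Finset F using htf
  refine ⟨t, fun x hx => by simpa using ht hx, fun S => ?_⟩
  -- Each unit vector is within `δ` of a point of the net, and the error term is absorbed on the
  -- left.
  have key : ‖S‖ ≤ ‖fun x : t => S x‖ + δ * ‖S‖ := by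
    refine S.opNorm_le_of_unit_norm (by positivity) fun x hx => ?_
    obtain ⟨z, hz, hxz⟩ := Set.mem_iUnion₂.1 (hcov (by simpa using hx.le : x ∈ _))
    calc ‖S x‖ = ‖S z + S (x - z)‖ := by rw [map_sub]; congr 1; abel
      _ ≤ ‖S z‖ + ‖S (x - z)‖ := norm_add_le _ _
      _ ≤ _ := by
        refine add_le_add (norm_le_pi_norm (fun x : t => S x) ⟨z, hz⟩) ?_
        rw [mul_comm]
        refine S.le_of_opNorm_le_of_le le_rfl ?_
        rw [← dist_eq_norm]
        exact (Metric.mem_ball.1 hxz).le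
  linarith

/-- A weak form of local reflexivity: a functional `S ↦ ∑ⱼ ⟨yⱼ*, S xⱼ⟩` on `L(F, Y)`, for `F`
finite dimensional, keeps its norm when it is extended to `L(F, Y**)`. -/
theorem norm_sum_apply_bidual_le [FiniteDimensional 𝕜 F] {k : Type*} [Fintype k] (x : k → F)
    (y : k → StrongDual 𝕜 Y) {C : ℝ} (hC : 0 ≤ C)
    (h : ∀ S : F →L[𝕜] Y, ‖∑ j, y j (S (x j))‖ ≤ C * ‖S‖)
    (T : F →ₗ[𝕜] StrongDual 𝕜 (StrongDual 𝕜 Y)) (hT : ∀ z, ‖T z‖ ≤ ‖z‖) :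
    ‖∑ j, T (x j) (y j)‖ ≤ C := by
  have key : ∀ δ : ℝ, 0 < δ → δ < 1 → (1 - δ) * ‖∑ j, T (x j) (y j)‖ ≤ C := by
    intro δ hδ hδ1
    have hδ' : 0 < 1 - δ := by linarith
    obtain ⟨t, ht, hnorm⟩ := exists_finite_norming.{v, w} 𝕜 F hδ
    -- Evaluation on the net embeds L(F, Y) into ℓ_∞^t(Y) with lower bound `1 - δ`, so `l` extends
    -- to ℓ_∞^t(Y) with norm at most `C / (1 - δ)`.
    let J : (F →L[𝕜] Y) →ₗ[𝕜] (t → Y) :=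
      { toFun := fun S i => S i
        map_add' := fun _ _ => rfl
        map_smul' := fun _ _ => rfl }
    let l : (F →L[𝕜] Y) →ₗ[𝕜] 𝕜 :=
      { toFun := fun S => ∑ j, y j (S (x j))
        map_add' := fun _ _ => by simp [Finset.sum_add_distrib]
        map_smul' := fun _ _ => by simp [Finset.mul_sum] }
    have hD : 0 ≤ C / (1 - δ) := by positivity
    obtain ⟨g, hg, hgle⟩ := exists_comp_eq_of_le_seminorm J l
      ((C / (1 - δ)).toNNReal • normSeminorm 𝕜 (t → Y)) fun S => by
        change _ ≤ ((C / (1 - δ)).toNNReal : ℝ) * ‖J S‖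
        rw [Real.coe_toNNReal _ hD, div_mul_eq_mul_div, le_div_iff₀ hδ']
        calc ‖l S‖ * (1 - δ) ≤ C * ‖S‖ * (1 - δ) := mul_le_mul_of_nonneg_right (h S) hδ'.le
          _ = C * ((1 - δ) * ‖S‖) := by ring
          _ ≤ C * ‖J S‖ := mul_le_mul_of_nonneg_left (hnorm S) hC
    obtain ⟨f, hf, hfC⟩ := exists_dual_components g hD fun z => by
      have : ‖g z‖ ≤ ((C / (1 - δ)).toNNReal : ℝ) * ‖z‖ := hgle z
      rwa [Real.coe_toNNReal _ hD] at this
    -- Testing on rank one operators shows that ∑ xⱼ⊗yⱼ and ∑ i⊗fᵢ are the same element of F⊗Y*.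
    -- Hence every linear map from `F` to Y** pairs equally with both.
    have hrank : ∀ e : StrongDual 𝕜 F, ∑ j, e (x j) • y j = ∑ i : t, e i • f i := by
      intro e
      ext z
      have h1 := hg (e.smulRight z)
      rw [hf] at h1
      simpa [J, l] using h1.symm
    let b := Module.finBasis 𝕜 F
    have hTb : ∀ (z : F) (w : StrongDual 𝕜 Y), T z w = ∑ i, T (b i) (b.repr z i • w) := by
      intro z w
      conv_lhs => rw [← b.sum_repr z, map_sum]
      simp
    have hsum : ∑ j, T (x j) (y j) = ∑ i : t, T i (f i) := by
      simp_rw [hTb _ (y _), hTb _ (f _)]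
      rw [Finset.sum_comm, Finset.sum_comm (s := Finset.univ (α := t))]
      refine Finset.sum_congr rfl fun i _ => ?_
      rw [← map_sum, ← map_sum]
      congr 1
      exact hrank (b.coord i).toContinuousLinearMap
    -- The second representation has vectors `i` in the unit ball and ∑ ‖fᵢ‖ ≤ C / (1 - δ).
    rw [hsum, mul_comm, ← le_div_iff₀ hδ']
    refine (norm_sum_le_of_le _ fun i _ => ?_).trans hfC
    exact ((T i).le_of_opNorm_le ((hT i).trans (ht i i.2)) _).trans_eq (one_mul _)
  have hlim : Filter.Tendsto (fun δ : ℝ => (1 - δ) * ‖∑ j, T (x j) (y j)‖) (𝓝[>] 0)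
      (𝓝 ‖∑ j, T (x j) (y j)‖) := by
    have : Continuous fun δ : ℝ => (1 - δ) * ‖∑ j, T (x j) (y j)‖ := by fun_prop
    simpa using (this.tendsto 0).mono_left nhdsWithin_le_nhds
  refine le_of_tendsto hlim ?_
  filter_upwards [Ioo_mem_nhdsGT (zero_lt_one' ℝ)] with δ hδ using key δ hδ.1 hδ.2

end Bidual

/-! ### Tensor products -/

section Tensor

/-- If functionals with the property `P` are nonzero at each given point outside the range of `K`,
then `id ⊗ h` is nonzero, for some such `h`, at each given tensor outside the range of `id ⊗ K`. -/
theorem exists_lTensor_ne_zero_of_notMem_range {𝕜 : Type*} [Field 𝕜] {A B D : Type*}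
    [AddCommGroup A] [Module 𝕜 A] [AddCommGroup B] [Module 𝕜 B] [AddCommGroup D] [Module 𝕜 D]
    (K : D →ₗ[𝕜] B) (P : (B →ₗ[𝕜] 𝕜) → Prop)
    (hP : ∀ b ∉ LinearMap.range K, ∃ h, P h ∧ h b ≠ 0) (u : A ⊗[𝕜] B)
    (hu : u ∉ Set.range (TensorProduct.map (LinearMap.id : A →ₗ[𝕜] A) K)) :
    ∃ h, P h ∧ TensorProduct.rid 𝕜 A (TensorProduct.map LinearMap.id h u) ≠ 0 := by
  classical
  obtain ⟨b⟩ : Nonempty (Module.Basis (Module.Basis.ofVectorSpaceIndex 𝕜 A) 𝕜 A) :=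
    ⟨Module.Basis.ofVectorSpace 𝕜 A⟩
  -- Write u = ∑ bᵢ⊗cᵢ along a basis of `A`. Some `c i` lies outside the range of `K`, and `h (c i)`
  -- is the i-th coordinate of (id⊗h)(u).
  obtain ⟨c, rfl⟩ := (TensorProduct.equivFinsuppOfBasisLeft (N := B) b).symm.surjective u
  rw [TensorProduct.equivFinsuppOfBasisLeft_symm_apply] at hu ⊢
  have : ∃ i, c i ∉ LinearMap.range K := by
    by_contra! hc
    refine hu ?_
    change _ ∈ LinearMap.range _
    refine Submodule.sum_mem _ fun i _ => ?_
    obtain ⟨d, hd⟩ := hc i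
    exact ⟨b i ⊗ₜ d, by simp [hd]⟩
  obtain ⟨i, hi⟩ := this
  obtain ⟨h, hPh, hne⟩ := hP _ hi
  refine ⟨h, hPh, fun h0 => hne ?_⟩
  have := congrArg (fun a => b.repr a i) h0
  simp only [Finsupp.sum, map_sum, TensorProduct.map_tmul, LinearMap.id_apply,
    TensorProduct.rid_tmul, map_smul, Finsupp.coe_finsetSum, Finset.sum_apply] at this
  by_contra hne
  have hc : c i ≠ 0 := fun hc => hne (by simp [hc])
  simp [Finsupp.single_apply, hc] at this
  exact hne this

end Tensor

/-- A closed subspace is separated from the points outside it by bounded functionals. -/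
theorem exists_strongDual_of_notMem {𝕜 : Type*} [RCLike 𝕜] {B : Type*} [NormedAddCommGroup B]
    [NormedSpace 𝕜 B] (p : Submodule 𝕜 B) (hp : IsClosed (p : Set B)) {b : B} (hb : b ∉ p) :
    ∃ h : StrongDual 𝕜 B, (∀ x ∈ p, h x = 0) ∧ h b ≠ 0 := by
  -- Closedness turns the quotient seminorm into a norm, so a functional norming the nonzero class
  -- of `b` can be pulled back.
  have : IsClosed (p : Set B) := hp
  have hb' : ‖(Submodule.Quotient.mk b : B ⧸ p)‖ ≠ 0 := by
    rwa [norm_ne_zero_iff, Ne, Submodule.Quotient.mk_eq_zero]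
  obtain ⟨g, -, hg⟩ := exists_dual_vector 𝕜 _ hb'
  refine ⟨g ∘L p.mkQL, fun x hx => ?_, ?_⟩
  · simp [(Submodule.Quotient.mk_eq_zero p).2 hx]
  · change g (Submodule.Quotient.mk b) ≠ 0
    rw [hg]
    exact_mod_cast hb'

/-! ### The projective norm and restrictions of the canonical extension -/

section Projective

variable {𝕜 : Type} [RCLike 𝕜] {n : ℕ} {X : Fin n → Type u}
  [∀ i, NormedAddCommGroup (X i)] [∀ i, NormedSpace 𝕜 (X i)]
  {Y : Type u} [NormedAddCommGroup Y] [NormedSpace 𝕜 Y]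

theorem projectiveSums_nonempty (u : (⨂[𝕜] i, X i) ⊗[𝕜] Y) :
    (projectiveSums u).Nonempty := by
  suffices h : ∃ (k : ℕ) (x : Fin k → ∀ i, X i) (y : Fin k → Y),
      u = ∑ j, (⨂ₜ[𝕜] i, x j i) ⊗ₜ[𝕜] y j by
    obtain ⟨k, x, y, h⟩ := h
    exact ⟨_, k, x, y, h, rfl⟩
  have hadd : ∀ u v : (⨂[𝕜] i, X i) ⊗[𝕜] Y,
      (∃ (k : ℕ) (x : Fin k → ∀ i, X i) (y : Fin k → Y),
        u = ∑ j, (⨂ₜ[𝕜] i, x j i) ⊗ₜ[𝕜] y j) →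
      (∃ (k : ℕ) (x : Fin k → ∀ i, X i) (y : Fin k → Y),
        v = ∑ j, (⨂ₜ[𝕜] i, x j i) ⊗ₜ[𝕜] y j) →
      ∃ (k : ℕ) (x : Fin k → ∀ i, X i) (y : Fin k → Y),
        u + v = ∑ j, (⨂ₜ[𝕜] i, x j i) ⊗ₜ[𝕜] y j := by
    rintro _ _ ⟨k, x, y, rfl⟩ ⟨l, x', y', rfl⟩
    exact ⟨k + l, Fin.append x x', Fin.append y y', by simp [Fin.sum_univ_add]⟩
  induction u with
  | zero => exact ⟨0, Fin.elim0, Fin.elim0, by simp⟩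
  | add u v hu hv => exact hadd u v hu hv
  | tmul p y =>
    induction p using PiTensorProduct.induction_on with
    | smul_tprod c x =>
      exact ⟨1, fun _ => x, fun _ => c • y, by simp [TensorProduct.smul_tmul]⟩
    | add p q hp hq =>
      rw [TensorProduct.add_tmul]
      exact hadd _ _ hp hq

/-- Allows `q = 0` in S1, which then bounds α^β on elementary tensors; a zero factor exists because
n ≥ 1. -/
theorem zero_mem_decomposable [NeZero n] : (0 : ⨂[𝕜] i, X i) ∈ decomposable 𝕜 X :=
  ⟨0, ((PiTensorProduct.tprod 𝕜).map_coord_zero (0 : Fin n) rfl).symm⟩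

theorem ReasonableCrossnorm.tprod_le (β : ReasonableCrossnorm 𝕜 X) (x : ∀ i, X i) :
    β (⨂ₜ[𝕜] i, x i) ≤ ∏ i, ‖x i‖ :=
  (β.le_projectiveNorm _).trans (PiTensorProduct.projectiveSeminorm_tprod_le x)

theorem canonicalExtension_bidualInclusion (φ : (⨂[𝕜] i, X i) ⊗[𝕜] Y →ₗ[𝕜] 𝕜)
    (h : IsProjectivelyBdd φ) (u : (⨂[𝕜] i, X i) ⊗[𝕜] Y) :
    canonicalExtension φ h (bidualInclusion 𝕜 X Y u) = φ u := by
  suffices canonicalExtension φ h ∘ₗ bidualInclusion 𝕜 X Y = φ from LinearMap.congr_fun this u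
  ext x y
  simp [bidualInclusion, canonicalExtension_tmul, associatedOperator_apply]

theorem lift_associatedOperator_apply (φ : (⨂[𝕜] i, X i) ⊗[𝕜] Y →ₗ[𝕜] 𝕜)
    (h : IsProjectivelyBdd φ) (p : ⨂[𝕜] i, X i) (y : Y) :
    PiTensorProduct.lift (associatedOperator φ h).toMultilinearMap p y = φ (p ⊗ₜ y) := by
  induction p using PiTensorProduct.induction_on with
  | smul_tprod c x =>
    simp [associatedOperator_apply, ← TensorProduct.smul_tmul']
  | add p q hp hq => simp [hp, hq, TensorProduct.add_tmul]

theorem lift_tprod_comp_subtype (E : ∀ i, Submodule 𝕜 (X i)) :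
    PiTensorProduct.lift ((PiTensorProduct.tprod 𝕜).compLinearMap fun i => (E i).subtype) =
      inclusion E := by
  ext x
  simp [inclusion]

end Projective

namespace SigmaTensorNorm

/-! ### Estimates for `Σ`-tensor norms -/

variable {𝕜 : Type} [RCLike 𝕜] (α : SigmaTensorNorm.{u} 𝕜) {n : ℕ} [NeZero n]
  {X : Fin n → Type u} [∀ i, NormedAddCommGroup (X i)] [∀ i, NormedSpace 𝕜 (X i)]
  [∀ i, CompleteSpace (X i)]
  {Y : Type u} [NormedAddCommGroup Y] [NormedSpace 𝕜 Y] [CompleteSpace Y]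
  (β : ReasonableCrossnorm 𝕜 X)

/-- S1 with `q = 0` and β ≤ π bound each term of a representation of `u`; then the infimum over
representations is taken. -/
theorem norm_le_projectiveNorm (u : (⨂[𝕜] i, X i) ⊗[𝕜] Y) :
    α.norm X Y β u ≤ projectiveNorm u := by
  refine le_csInf (projectiveSums_nonempty u) ?_
  rintro _ ⟨k, x, y, rfl, rfl⟩
  refine (Finset.le_sum_of_subadditive (α.norm X Y β) (map_zero _).le (map_add_le_add _)
    _ _).trans (Finset.sum_le_sum fun j _ => ?_)
  have h := α.norm_sub_tmul_le X Y β _ 0 ⟨x j, rfl⟩ zero_mem_decomposable (y j)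
  rw [sub_zero] at h
  exact h.trans (mul_le_mul_of_nonneg_right (β.tprod_le _) (norm_nonneg _))

variable {β} in
theorem isProjectivelyBdd_of_isBdd {φ : (⨂[𝕜] i, X i) ⊗[𝕜] Y →ₗ[𝕜] 𝕜}
    (hφ : IsBdd (α.norm X Y β) (fun c : 𝕜 => ‖c‖) φ) : IsProjectivelyBdd φ :=
  ⟨_, fun u => (hφ.le_opNorm (apply_nonneg _) u).trans
    (mul_le_mul_of_nonneg_left (α.norm_le_projectiveNorm β u) (opNorm_nonneg _ _ _))⟩

/-- S3 for the canonical multilinear map, whose linearization is the identity, and the contraction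
K_Y. -/
theorem norm_bidualInclusion_le (u : (⨂[𝕜] i, X i) ⊗[𝕜] Y) :
    α.norm X (StrongDual 𝕜 (StrongDual 𝕜 Y)) β (bidualInclusion 𝕜 X Y u) ≤ α.norm X Y β u := by
  have hid : PiTensorProduct.lift (PiTensorProduct.tprod 𝕜 (s := X)) = LinearMap.id :=
    PiTensorProduct.lift_tprod
  have hle : ∀ p, β (PiTensorProduct.lift (PiTensorProduct.tprod 𝕜 (s := X)) p) ≤ 1 * β p :=
    fun p => by simp [hid]
  obtain ⟨h1, h2⟩ := α.map_bound X (StrongDual 𝕜 (StrongDual 𝕜 Y)) β X Y β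
    (PiTensorProduct.tprod 𝕜) ⟨fun x => ⟨x, rfl⟩, 1, hle⟩ (NormedSpace.inclusionInDoubleDual 𝕜 Y)
  rw [hid] at h1 h2
  refine (h1.le_opNorm (apply_nonneg _) u).trans
    (mul_le_of_le_one_left (apply_nonneg _ _) (h2.trans ?_))
  refine mul_le_one₀ (opNorm_le zero_le_one fun p => by simp) (norm_nonneg _)
    (NormedSpace.inclusionInDoubleDual_norm_le 𝕜 Y)

/-- S3 for the inclusion of E₁⊗⋯⊗Eₙ, which preserves norms by the definition of β|, so that only ‖S‖
remains. -/
theorem norm_map_inclusion_le (E : ∀ i, Submodule 𝕜 (X i)) {Z : Type u} [NormedAddCommGroup Z]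
    [NormedSpace 𝕜 Z] (F : Submodule 𝕜 Z) [∀ i, FiniteDimensional 𝕜 (E i)]
    [FiniteDimensional 𝕜 F] (S : F →L[𝕜] Y) (v : (⨂[𝕜] i, E i) ⊗[𝕜] F) :
    α.norm X Y β (TensorProduct.map (inclusion E) S.toLinearMap v) ≤
      ‖S‖ * α.restrictNorm β E F v := by
  have : ∀ i, CompleteSpace (E i) := fun i => FiniteDimensional.complete 𝕜 (E i)
  have : CompleteSpace F := FiniteDimensional.complete 𝕜 F
  have hle : ∀ p, β (inclusion E p) ≤ 1 * β.restrict E p := fun p => (one_mul _).ge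
  obtain ⟨h1, h2⟩ := α.map_bound X Y β (fun i => E i) F (β.restrict E)
    ((PiTensorProduct.tprod 𝕜).compLinearMap fun i => (E i).subtype)
    ⟨fun x => ⟨fun i => x i, rfl⟩, 1, by rwa [lift_tprod_comp_subtype]⟩ S
  rw [lift_tprod_comp_subtype] at h1 h2
  exact (h1.le_opNorm (apply_nonneg _) v).trans (mul_le_mul_of_nonneg_right
    (h2.trans (mul_le_of_le_one_left (norm_nonneg S) (opNorm_le zero_le_one hle)))
    (apply_nonneg _ _))

variable {β} in
-- For v = ∑ eⱼ⊗fⱼ, both φ((incl⊗S)v) and the value of φ̄ are pairings of the fⱼ with the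
-- functionals T_φ(eⱼ), through `S` into Y and through `T` into Y**. S3 bounds the first uniformly
-- in `S`, and local reflexivity transfers the bound to the second.
theorem norm_canonicalExtension_map_subtype_le
    {φ : (⨂[𝕜] i, X i) ⊗[𝕜] Y →ₗ[𝕜] 𝕜} (h : IsProjectivelyBdd φ) {C : ℝ} (hC : 0 ≤ C)
    (hφ : ∀ u, ‖φ u‖ ≤ C * α.norm X Y β u)
    (E : ∀ i, Submodule 𝕜 (X i)) {Z : Type u} [NormedAddCommGroup Z]
    [NormedSpace 𝕜 Z] (F : Submodule 𝕜 Z) [∀ i, FiniteDimensional 𝕜 (E i)]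
    [FiniteDimensional 𝕜 F] (T : Z →ₗ[𝕜] StrongDual 𝕜 (StrongDual 𝕜 Y)) (hT : ∀ z, ‖T z‖ ≤ ‖z‖)
    (v : (⨂[𝕜] i, E i) ⊗[𝕜] F) :
    ‖canonicalExtension φ h (TensorProduct.map (inclusion E) (T ∘ₗ F.subtype) v)‖ ≤
      C * α.restrictNorm β E F v := by
  obtain ⟨k, e, f, hv⟩ := TensorProduct.exists_sum_tmul_eq v
  let L := PiTensorProduct.lift (associatedOperator φ h).toMultilinearMap
  have hbound := norm_sum_apply_bidual_le (𝕜 := 𝕜) f (fun j => L (inclusion E (e j)))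
    (mul_nonneg hC (apply_nonneg (α.restrictNorm β E F) v)) (fun S => by
      have hS : ∑ j, L (inclusion E (e j)) (S (f j)) =
          φ (TensorProduct.map (inclusion E) S.toLinearMap v) := by
        simp [hv, L, lift_associatedOperator_apply]
      rw [hS]
      calc _ ≤ C * α.norm X Y β (TensorProduct.map (inclusion E) S.toLinearMap v) := hφ _
        _ ≤ C * (‖S‖ * α.restrictNorm β E F v) :=
          mul_le_mul_of_nonneg_left (α.norm_map_inclusion_le β E F S v) hC
        _ = _ := by ring)
    (T ∘ₗ F.subtype) fun z => hT z
  refine le_of_eq_of_le (congrArg _ ?_) hbound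
  conv_lhs => rw [hv]
  simp [canonicalExtension, L]

variable {α β} in
theorem FinitelyGenerated.norm_canonicalExtension_map_le (hα : α.FinitelyGenerated)
    {φ : (⨂[𝕜] i, X i) ⊗[𝕜] Y →ₗ[𝕜] 𝕜} (h : IsProjectivelyBdd φ) {C : ℝ} (hC : 0 ≤ C)
    (hφ : ∀ u, ‖φ u‖ ≤ C * α.norm X Y β u) {Z : Type u} [NormedAddCommGroup Z]
    [NormedSpace 𝕜 Z] [CompleteSpace Z] (T : Z →ₗ[𝕜] StrongDual 𝕜 (StrongDual 𝕜 Y))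
    (hT : ∀ z, ‖T z‖ ≤ ‖z‖) (u : (⨂[𝕜] i, X i) ⊗[𝕜] Z) :
    ‖canonicalExtension φ h (TensorProduct.map LinearMap.id T u)‖ ≤ C * α.norm X Z β u := by
  have key : ∀ (E : ∀ i, Submodule 𝕜 (X i)) (F : Submodule 𝕜 Z)
      (_ : ∀ i, FiniteDimensional 𝕜 (E i)) (_ : FiniteDimensional 𝕜 F)
      (v : (⨂[𝕜] i, E i) ⊗[𝕜] F),
      ‖canonicalExtension φ h (TensorProduct.map LinearMap.id T
        (TensorProduct.map (inclusion E) F.subtype v))‖ ≤ C * α.restrictNorm β E F v := by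
    intro E F _ _ v
    have := α.norm_canonicalExtension_map_subtype_le h hC hφ E F T hT v
    rwa [TensorProduct.map_map, LinearMap.id_comp]
  rcases hC.eq_or_lt with rfl | hC
  -- For `C = 0` division is impossible, but a single finite dimensional representation of `u`
  -- suffices.
  · obtain ⟨_, E, F, hE, hF, v, rfl, -⟩ := (hα X Z β u).nonempty
    simpa using key E F hE hF v
  · rw [← div_le_iff₀' hC]
    refine (hα X Z β u).2 ?_
    rintro _ ⟨E, F, hE, hF, v, rfl, rfl⟩
    rw [div_le_iff₀' hC]
    exact key E F hE hF v

variable {α β} in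
/-- The canonical extension of a functional does not increase its norm. -/
theorem FinitelyGenerated.norm_canonicalExtension_le (hα : α.FinitelyGenerated)
    {φ : (⨂[𝕜] i, X i) ⊗[𝕜] Y →ₗ[𝕜] 𝕜} (h : IsProjectivelyBdd φ) {C : ℝ} (hC : 0 ≤ C)
    (hφ : ∀ u, ‖φ u‖ ≤ C * α.norm X Y β u)
    (u : (⨂[𝕜] i, X i) ⊗[𝕜] StrongDual 𝕜 (StrongDual 𝕜 Y)) :
    ‖canonicalExtension φ h u‖ ≤ C * α.norm X (StrongDual 𝕜 (StrongDual 𝕜 Y)) β u := by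
  have := hα.norm_canonicalExtension_map_le h hC hφ
    (Z := StrongDual 𝕜 (StrongDual 𝕜 Y)) LinearMap.id (fun _ => le_rfl) u
  rwa [TensorProduct.map_id, LinearMap.id_apply] at this

variable {α} in
-- A functional of norm at most one that norms `u` keeps its bound after canonical extension and its
-- value at the image of `u`.
theorem FinitelyGenerated.norm_bidualInclusion (hα : α.FinitelyGenerated)
    (u : (⨂[𝕜] i, X i) ⊗[𝕜] Y) :
    α.norm X (StrongDual 𝕜 (StrongDual 𝕜 Y)) β (bidualInclusion 𝕜 X Y u) = α.norm X Y β u := by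
  refine (α.norm_bidualInclusion_le β u).antisymm ?_
  obtain ⟨φ, hφ, hu⟩ := exists_functional_apply_eq (α.norm X Y β) u
  have hb : IsBdd (α.norm X Y β) (fun c : 𝕜 => ‖c‖) φ := ⟨1, fun v => by simpa using hφ v⟩
  have h := hα.norm_canonicalExtension_le (α.isProjectivelyBdd_of_isBdd hb) zero_le_one
    (fun v => by simpa using hφ v) (bidualInclusion 𝕜 X Y u)
  rwa [canonicalExtension_bidualInclusion, hu, one_mul] at h

/-- The functional is ψ⊗h: `h` vanishes on the range of `K`, which is closed since Y is complete,
and leaves w = (id⊗h)(u) ≠ 0; ψ norms `w` for β. S2 gives boundedness. -/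
theorem exists_functional_of_notMem_range {B : Type u} [NormedAddCommGroup B] [NormedSpace 𝕜 B]
    [CompleteSpace B] (K : Y →ₗᵢ[𝕜] B) (u : (⨂[𝕜] i, X i) ⊗[𝕜] B)
    (hu : u ∉ Set.range (TensorProduct.map (LinearMap.id : (⨂[𝕜] i, X i) →ₗ[𝕜] _)
      K.toLinearMap)) :
    ∃ g : (⨂[𝕜] i, X i) ⊗[𝕜] B →ₗ[𝕜] 𝕜,
      IsBdd (α.norm X B β) (fun c : 𝕜 => ‖c‖) g ∧
        (∀ s ∈ Set.range (TensorProduct.map (LinearMap.id : (⨂[𝕜] i, X i) →ₗ[𝕜] _)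
          K.toLinearMap), g s = 0) ∧ g u ≠ 0 := by
  obtain ⟨_, ⟨h, hK, rfl⟩, hne⟩ := exists_lTensor_ne_zero_of_notMem_range K.toLinearMap
    (fun l => ∃ h : StrongDual 𝕜 B, (∀ y, h (K y) = 0) ∧ h.toLinearMap = l) (fun b hb => by
      obtain ⟨g, hg, hgb⟩ := exists_strongDual_of_notMem (LinearMap.range K.toLinearMap)
        K.isometry.isClosedEmbedding.isClosed_range hb
      exact ⟨_, ⟨g, fun y => hg _ ⟨y, rfl⟩, rfl⟩, hgb⟩) u hu
  set w := TensorProduct.rid 𝕜 _ (TensorProduct.map LinearMap.id h.toLinearMap u)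
  obtain ⟨ψ, hψ, hψw⟩ := exists_functional_apply_eq β.toSeminorm w
  have hψ0 : ψ w ≠ 0 := fun h0 => hne (β.eq_zero_of_apply_eq_zero w (by
    rw [← hψw, h0, norm_zero]))
  have hlift : PiTensorProduct.lift (ψ.compMultilinearMap (PiTensorProduct.tprod 𝕜)) = ψ := by
    ext x
    simp
  have hbdd := (α.functional_bound X B β
    (ψ.compMultilinearMap (PiTensorProduct.tprod 𝕜)) (by
      rw [hlift]
      exact ⟨1, fun p => by simpa using hψ p⟩) h).1
  rw [hlift] at hbdd
  refine ⟨_, hbdd, ?_, ?_⟩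
  · rintro _ ⟨v, rfl⟩
    induction v with
    | zero => simp
    | add v v' hv hv' => rw [map_add, map_add, hv, hv', add_zero]
    | tmul p y => simp [hK y]
  · have : ∀ v, (LinearMap.mul' 𝕜 𝕜 ∘ₗ TensorProduct.map ψ h.toLinearMap) v =
        ψ (TensorProduct.rid 𝕜 _ (TensorProduct.map LinearMap.id h.toLinearMap v)) := by
      intro v
      induction v with
      | zero => simp
      | add v v' hv hv' => simp only [map_add, hv, hv']
      | tmul p y => simp [mul_comm]
    rwa [this]

theorem isClosed_range_bidualInclusion :
    IsClosed[normTopology (α.norm X (StrongDual 𝕜 (StrongDual 𝕜 Y)) β)]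
      (Set.range (bidualInclusion 𝕜 X Y)) := by
  have h := isClosed_of_forall_exists_functional _ _
    (α.exists_functional_of_notMem_range β
      (B := StrongDual 𝕜 (StrongDual 𝕜 Y)) (NormedSpace.inclusionInDoubleDualLi 𝕜 (E := Y)))
  exact h

end SigmaTensorNorm

end SigmaTensor

theorem mainTheorem5 {𝕜 : Type} [RCLike 𝕜]
    (α : SigmaTensor.SigmaTensorNorm.{u} 𝕜) (hα : α.FinitelyGenerated)
    {n : ℕ} [NeZero n] (X : Fin n → Type u) [∀ i, NormedAddCommGroup (X i)]
    [∀ i, NormedSpace 𝕜 (X i)] [∀ i, CompleteSpace (X i)]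
    (Y : Type u) [NormedAddCommGroup Y] [NormedSpace 𝕜 Y] [CompleteSpace Y]
    (β : SigmaTensor.ReasonableCrossnorm 𝕜 X) :
    -- (i) `I ⊗ K_Y` is an isometric embedding with closed range
    ((∀ u : (⨂[𝕜] i, X i) ⊗[𝕜] Y,
        α.norm X (StrongDual 𝕜 (StrongDual 𝕜 Y)) β (SigmaTensor.bidualInclusion 𝕜 X Y u) =
          α.norm X Y β u) ∧
      IsClosed[SigmaTensor.normTopology (α.norm X (StrongDual 𝕜 (StrongDual 𝕜 Y)) β)]
        (Set.range (SigmaTensor.bidualInclusion 𝕜 X Y))) ∧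
    -- (ii) `φ` is `α^β`-bounded iff its canonical extension is defined and `α^β`-bounded
    (∀ φ : (⨂[𝕜] i, X i) ⊗[𝕜] Y →ₗ[𝕜] 𝕜,
      (SigmaTensor.IsBdd (α.norm X Y β) (fun c : 𝕜 => ‖c‖) φ ↔
        ∃ h : SigmaTensor.IsProjectivelyBdd φ,
          SigmaTensor.IsBdd (α.norm X (StrongDual 𝕜 (StrongDual 𝕜 Y)) β) (fun c : 𝕜 => ‖c‖)
            (SigmaTensor.canonicalExtension φ h)) ∧
      (SigmaTensor.IsBdd (α.norm X Y β) (fun c : 𝕜 => ‖c‖) φ →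
        ∀ h : SigmaTensor.IsProjectivelyBdd φ,
          SigmaTensor.opNorm (α.norm X Y β) (fun c : 𝕜 => ‖c‖) φ =
            SigmaTensor.opNorm (α.norm X (StrongDual 𝕜 (StrongDual 𝕜 Y)) β)
              (fun c : 𝕜 => ‖c‖) (SigmaTensor.canonicalExtension φ h))) := by
  -- Bounds for φ̄ restrict to φ with the same constant, since I⊗K_Y is isometric and φ̄ extends φ
  -- along it.
  have hrestr : ∀ (φ : (⨂[𝕜] i, X i) ⊗[𝕜] Y →ₗ[𝕜] 𝕜) (h : SigmaTensor.IsProjectivelyBdd φ) (C : ℝ),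
      (∀ u, ‖SigmaTensor.canonicalExtension φ h u‖ ≤
        C * α.norm X (StrongDual 𝕜 (StrongDual 𝕜 Y)) β u) →
      ∀ u, ‖φ u‖ ≤ C * α.norm X Y β u := fun φ h C hC u => by
    rw [← hα.norm_bidualInclusion, ← SigmaTensor.canonicalExtension_bidualInclusion φ h]
    exact hC _
  have hext : ∀ (φ : (⨂[𝕜] i, X i) ⊗[𝕜] Y →ₗ[𝕜] 𝕜) (h : SigmaTensor.IsProjectivelyBdd φ),
      SigmaTensor.IsBdd (α.norm X Y β) (fun c : 𝕜 => ‖c‖) φ →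
      ∀ u, ‖SigmaTensor.canonicalExtension φ h u‖ ≤
        SigmaTensor.opNorm (α.norm X Y β) (fun c : 𝕜 => ‖c‖) φ *
          α.norm X (StrongDual 𝕜 (StrongDual 𝕜 Y)) β u := fun φ h hφ =>
    hα.norm_canonicalExtension_le h (SigmaTensor.opNorm_nonneg _ _ _)
      (hφ.le_opNorm (apply_nonneg _))
  refine ⟨⟨hα.norm_bidualInclusion β, α.isClosed_range_bidualInclusion β⟩,
    fun φ => ⟨⟨fun hφ => ?_, ?_⟩, fun hφ h => ?_⟩⟩
  · have h := α.isProjectivelyBdd_of_isBdd hφ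
    exact ⟨h, _, hext φ h hφ⟩
  · rintro ⟨h, C, hC⟩
    exact ⟨C, hrestr φ h C hC⟩
  · refine le_antisymm ?_ (SigmaTensor.opNorm_le (SigmaTensor.opNorm_nonneg _ _ _) (hext φ h hφ))
    refine SigmaTensor.opNorm_le (SigmaTensor.opNorm_nonneg _ _ _) (hrestr φ h _ ?_)
    exact SigmaTensor.IsBdd.le_opNorm (apply_nonneg _) ⟨_, hext φ h hφ⟩
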